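/- **The Refined Lecture Hall Theorem.** Let $n$ be a nonnegative integer. A lecture hall partition with $n$ parts is a sequence $\lambda=(\lambda_1,\dots,\lambda_n)$ of nonnegative integers with $$0\le \frac{\lambda_1}{1}\le\frac{\lambda_2}{2}\le\cdots\le\frac{\lambda_n}{n}.$$ For such a $\lambda$ put $|\lambda|=\sum_{i=1}^n\lambda_i$ and $\lceil\lambda\rceil=\left(\lceil\lambda_1/1\rceil,\lceil\lambda_2/2\rceil,\dots,\lceil\lambda_n/n\rceil\right)$, let $|\lceil\lambda\rceil|=\sum_{i=1}^n\lceil\lambda_i/i\rceil$, and let $o(\lceil\lambda\rceil)$ be the number of indices $i\in\{1,\dots,n\}$ for which $\lceil\lambda_i/i\rceil$ is odd. Then, as an identity of formal power series in $\mathbb{Z}[[x,u,v]]$, $$\sum_{\lambda}x^{|\lambda|}\,u^{|\lceil\lambda\rceil|}\,v^{o(\lceil\lambda\rceil)}=\frac{\prod_{i=1}^{n}(1+uvx^{i})}{\prod_{i=n+1}^{2n}(1-u^2x^{i})},$$ where the sum is over all lecture hall partitions $\lambda$ with $n$ parts. -/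

import Mathlib

open scoped MvPowerSeries.WithPiTopology

namespace LectureHall

/-- A lecture hall partition with `n` parts: nonnegative integers `lam_1, …, lam_n` with
`0 ≤ lam_1 / 1 ≤ lam_2 / 2 ≤ ⋯ ≤ lam_n / n`. The part `lam_j` is stored at the
index `j - 1 : Fin n`. Parts equal to zero are allowed. -/
def IsLectureHall {n : ℕ} (lam : Fin n → ℕ) : Prop :=
  Monotone fun i : Fin n => (lam i : ℚ) / ((i : ℚ) + 1)

/-- The sum of the entries of a sequence. -/
def size {n : ℕ} (a : Fin n → ℕ) : ℕ := ∑ i, a i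

/-- The sequence `(⌈lam_1 / 1⌉, ⌈lam_2 / 2⌉, …, ⌈lam_n / n⌉)`. -/
def ceilSeq {n : ℕ} (lam : Fin n → ℕ) : Fin n → ℕ :=
  fun i => ⌈(lam i : ℚ) / ((i : ℚ) + 1)⌉₊

/-- The number of (indices of) odd entries of a sequence. -/
def oddCount {n : ℕ} (a : Fin n → ℕ) : ℕ := (Finset.univ.filter fun i => Odd (a i)).card

/-- The ring `ℤ⟦x, u, v⟧` of formal power series in three variables; it carries the topology of
coefficientwise convergence, with `ℤ` discrete. -/
abbrev Series : Type := MvPowerSeries (Fin 3) ℤ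

/-- The variable `x`. -/
noncomputable def x : Series := MvPowerSeries.X 0

/-- The variable `u`. -/
noncomputable def u : Series := MvPowerSeries.X 1

/-- The variable `v`. -/
noncomputable def v : Series := MvPowerSeries.X 2

end LectureHall

/-! Ceilings of a lecture hall partition increase weakly, so `boundedSeries n (n * t)` counts those
with all ceilings at most `t`. Sort partitions by the number `k` of parts with ceiling above `t`;
these come last, and `tailSeries t k r` is their contribution with the final denominator cleared.
The resulting sum over `k + r = n` is independent of `t`: passing from `t` to `t + 1` moves the
parts of ceiling `t + 1` from the tail to the bounded part (`tailSeries_eq_sum`,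
`boundedSeries_mul_add`). At `t = 0` the q-Chu–Vandermonde identity evaluates it to the numerator.
Modulo `u ^ (t + 1)` only `k = 0` survives, leaving denominator times `boundedSeries n (n * t)`;
every coefficient is read off for large `t`. -/

open Finset.HasAntidiagonal (antidiagonal)

namespace LectureHall

/-! ### Gaussian binomials and q-Chu–Vandermonde -/

section GaussianBinomial

variable {R : Type*} [CommRing R]

/-- The Gaussian binomial coefficient `[n choose k]` at `q`. -/
def gaussBinom (q : R) : ℕ → ℕ → R
  | _, 0 => 1
  | 0, _ + 1 => 0
  | n + 1, k + 1 => q ^ (n - k) * gaussBinom q n k + gaussBinom q n (k + 1)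

@[simp]
lemma gaussBinom_zero_right (q : R) (n : ℕ) : gaussBinom q n 0 = 1 := by
  cases n <;> rfl

lemma gaussBinom_succ_succ (q : R) (n k : ℕ) :
    gaussBinom q (n + 1) (k + 1) = q ^ (n - k) * gaussBinom q n k + gaussBinom q n (k + 1) :=
  rfl

lemma gaussBinom_eq_zero_of_lt (q : R) {n k : ℕ} (h : n < k) : gaussBinom q n k = 0 := by
  induction n generalizing k with
  | zero => obtain _ | k := k <;> simp_all [gaussBinom]
  | succ n ih =>
    obtain _ | k := k
    · omega
    · rw [gaussBinom_succ_succ, ih (by omega), ih (by omega), mul_zero, add_zero]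

@[simp]
lemma gaussBinom_self (q : R) (n : ℕ) : gaussBinom q n n = 1 := by
  induction n with
  | zero => rfl
  | succ n ih => simp [gaussBinom_succ_succ, ih, gaussBinom_eq_zero_of_lt]

lemma sum_antidiagonal_gaussBinom_succ (q : R) (n N : ℕ) (f : ℕ → ℕ → R) :
    ∑ p ∈ antidiagonal (n + 1), gaussBinom q (N + 1) p.1 * f p.1 p.2 =
      ∑ p ∈ antidiagonal (n + 1), gaussBinom q N p.1 * f p.1 p.2 +
        ∑ p ∈ antidiagonal n, q ^ (N - p.1) * gaussBinom q N p.1 * f (p.1 + 1) p.2 := by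
  simp only [Finset.Nat.sum_antidiagonal_succ, gaussBinom_succ_succ, gaussBinom_zero_right,
    add_mul, Finset.sum_add_distrib]
  ring

/-- A form of the `q`-Chu–Vandermonde identity. -/
lemma qChuVandermonde (q X y w : R) (k : ℕ) :
    ∑ p ∈ antidiagonal k, gaussBinom q k p.1 *
        ((∏ j ∈ Finset.range p.1, (X * q ^ j + y * w)) *
          ∏ j ∈ Finset.range p.2, (w * (1 - y * q ^ j))) =
      ∏ j ∈ Finset.range k, (w + X * q ^ j) := by
  induction k with
  | zero => simp
  | succ k ih =>
    rw [sum_antidiagonal_gaussBinom_succ q k k fun l m =>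
        (∏ j ∈ Finset.range l, (X * q ^ j + y * w)) * ∏ j ∈ Finset.range m, (w * (1 - y * q ^ j)),
      Finset.Nat.sum_antidiagonal_succ', gaussBinom_eq_zero_of_lt q k.lt_succ_self, zero_mul,
      zero_add, ← Finset.sum_add_distrib, Finset.prod_range_succ, ← ih, Finset.sum_mul]
    -- At `(l, m)` the two Pascal terms contribute `w(1 - y q^m) + q^m (X q^l + y w) = w + X
    -- q^(l+m)`, the new factor.
    refine Finset.sum_congr rfl fun p hp => ?_
    obtain ⟨l, m⟩ := p
    obtain rfl : l + m = k := by simpa using hp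
    simp only [Finset.prod_range_succ, Nat.add_sub_cancel_left]
    ring

lemma gaussBinom_mul_prod (q : R) (k m : ℕ) :
    gaussBinom q (k + m) k * (∏ i ∈ Finset.range k, (1 - q ^ (i + 1))) *
        ∏ i ∈ Finset.range m, (1 - q ^ (i + 1)) =
      ∏ i ∈ Finset.range (k + m), (1 - q ^ (i + 1)) := by
  induction h : k + m generalizing k m with
  | zero => obtain ⟨rfl, rfl⟩ : k = 0 ∧ m = 0 := by omega
            simp
  | succ n ih =>
    obtain _ | k := k
    · obtain rfl : m = n + 1 := by omega
      simp
    obtain _ | m := m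
    · obtain rfl : k = n := by omega
      simp
    have h₁ := ih k (m + 1) (by omega)
    have h₂ := ih (k + 1) m (by omega)
    obtain rfl : n = k + m + 1 := by omega
    rw [gaussBinom_succ_succ, Finset.prod_range_succ _ (k + m + 1)]
    rw [Finset.prod_range_succ] at h₁ h₂
    rw [Finset.prod_range_succ _ k, Finset.prod_range_succ _ m,
      show k + m + 1 - k = m + 1 by omega]
    linear_combination q ^ (m + 1) * (1 - q ^ (k + 1)) * h₁ + (1 - q ^ (m + 1)) * h₂

/-- Both sides are the q-multinomial coefficient of `l, m, r`; `hq` allows cancelling the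
q-factorials. -/
lemma gaussBinom_mul_gaussBinom [NoZeroDivisors R] [Nontrivial R] {q : R} (hq : ∀ i : ℕ, q ^ (i + 1) ≠ 1)
    (l m r : ℕ) :
    gaussBinom q (l + m + r) l * gaussBinom q (m + r) m =
      gaussBinom q (l + m + r) (l + m) * gaussBinom q (l + m) l := by
  have hne (n : ℕ) : ∏ i ∈ Finset.range n, (1 - q ^ (i + 1)) ≠ 0 :=
    Finset.prod_ne_zero_iff.2 fun i _ => sub_ne_zero.2 (hq i).symm
  refine mul_right_cancel₀ (mul_ne_zero (mul_ne_zero (hne l) (hne m)) (hne r)) ?_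
  have h₁ := gaussBinom_mul_prod q l (m + r)
  have h₂ := gaussBinom_mul_prod q (l + m) r
  rw [← gaussBinom_mul_prod q m r, ← add_assoc] at h₁
  rw [← gaussBinom_mul_prod q l m] at h₂
  linear_combination h₁ - h₂

end GaussianBinomial

/-! ### Lecture hall partitions with bounded last part -/

/-- The weight `u ^ c * v ^ [c odd]` of a ceiling `c`. -/
noncomputable def ceilWeight (c : ℕ) : Series := u ^ c * v ^ (c % 2)

/-- By transitivity only the last old part has to be compared with `m`; the condition is vacuous for
`n = 0`. -/
lemma isLectureHall_snoc {n : ℕ} (lam : Fin n → ℕ) (m : ℕ) :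
    IsLectureHall (Fin.snoc lam m : Fin (n + 1) → ℕ) ↔
      IsLectureHall lam ∧ ∀ i : Fin n, (i : ℕ) + 1 = n → lam i ≤ m * n / (n + 1) := by
  unfold IsLectureHall
  constructor
  · intro h
    refine ⟨fun i j hij => ?_, fun i hi => ?_⟩
    · simpa using h (Fin.castSucc_le_castSucc_iff.2 hij)
    · have := h (Fin.le_last i.castSucc)
      simp only [Fin.snoc_castSucc, Fin.snoc_last, Fin.val_castSucc, Fin.val_last] at this
      rw [div_le_div_iff₀ (by positivity) (by positivity)] at this
      rw [Nat.le_div_iff_mul_le (by omega)]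
      have h' : (i : ℚ) + 1 = n := by exact_mod_cast hi
      rw [h'] at this
      exact_mod_cast this
  · rintro ⟨h, hm⟩ i j hij
    induction j using Fin.lastCases with
    | last =>
      induction i using Fin.lastCases with
      | last => exact le_rfl
      | cast i =>
        simp only [Fin.snoc_castSucc, Fin.snoc_last, Fin.val_castSucc, Fin.val_last]
        obtain ⟨k, rfl⟩ : ∃ k, n = k + 1 := ⟨n - 1, by have := i.isLt; omega⟩
        refine (h (Fin.le_last i)).trans ?_
        have := hm (Fin.last k) (by simp)
        rw [Nat.le_div_iff_mul_le (by omega)] at this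
        simp only [Fin.val_last]
        rw [div_le_div_iff₀ (by positivity) (by positivity)]
        exact_mod_cast this
    | cast j =>
      induction i using Fin.lastCases with
      | last => exact absurd hij (not_le.2 (Fin.castSucc_lt_last j))
      | cast i => simpa using h (Fin.castSucc_le_castSucc_iff.1 hij)

/-- Appending a last part, as an embedding. -/
def snocEmbedding (n : ℕ) : (_ : ℕ) × (Fin n → ℕ) ↪ (Fin (n + 1) → ℕ) where
  toFun p := Fin.snoc p.2 p.1
  inj' p p' h := by
    obtain ⟨h₂, h₁⟩ := Fin.snoc_injective2 h
    exact Sigma.ext h₁ (heq_of_eq h₂)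

lemma snocEmbedding_apply {n : ℕ} (p : (_ : ℕ) × (Fin n → ℕ)) :
    snocEmbedding n p = Fin.snoc p.2 p.1 :=
  rfl

/-- The lecture hall partitions with `n` parts whose last part is at most `M`. -/
def boundedLectureHall : (n : ℕ) → ℕ → Finset (Fin n → ℕ)
  | 0, _ => Finset.univ
  | n + 1, M => ((Finset.range (M + 1)).sigma fun m => boundedLectureHall n (m * n / (n + 1))).map
      (snocEmbedding n)

lemma mem_boundedLectureHall {n M : ℕ} (lam : Fin n → ℕ) :
    lam ∈ boundedLectureHall n M ↔
      IsLectureHall lam ∧ ∀ i : Fin n, (i : ℕ) + 1 = n → lam i ≤ M := by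
  induction n generalizing M with
  | zero => simp [boundedLectureHall, IsLectureHall, Subsingleton.monotone,
      eq_iff_true_of_subsingleton]
  | succ n ih =>
    have hlast : (∀ i : Fin (n + 1), (i : ℕ) + 1 = n + 1 → lam i ≤ M) ↔ lam (Fin.last n) ≤ M :=
      ⟨fun h => h _ rfl, fun h i hi => by rwa [show i = Fin.last n from Fin.ext (by simpa using hi)]⟩
    rw [hlast]
    constructor
    · intro h
      simp only [boundedLectureHall, Finset.mem_map, Finset.mem_sigma, Finset.mem_range, ih,
        snocEmbedding_apply, ← isLectureHall_snoc] at h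
      obtain ⟨p, ⟨hp, hl⟩, rfl⟩ := h
      exact ⟨hl, by simpa using Nat.lt_succ_iff.1 hp⟩
    · rintro ⟨hl, hM⟩
      simp only [boundedLectureHall, Finset.mem_map, Finset.mem_sigma, Finset.mem_range, ih,
        snocEmbedding_apply, ← isLectureHall_snoc]
      exact ⟨⟨lam (Fin.last n), Fin.init lam⟩,
        ⟨Nat.lt_succ_of_le hM, by simpa using hl⟩, by simp⟩

/-- The monomial attached to a sequence. -/
noncomputable def weight {n : ℕ} (lam : Fin n → ℕ) : Series :=
  x ^ size lam * u ^ size (ceilSeq lam) * v ^ oddCount (ceilSeq lam)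

lemma weight_eq_prod {n : ℕ} (lam : Fin n → ℕ) :
    weight lam = ∏ i, (x ^ lam i * ceilWeight (ceilSeq lam i)) := by
  have h : oddCount (ceilSeq lam) = ∑ i, ceilSeq lam i % 2 := by
    rw [oddCount, Finset.card_filter]
    refine Finset.sum_congr rfl fun i _ => ?_
    split_ifs with hi
    · exact (Nat.odd_iff.1 hi).symm
    · exact (Nat.even_iff.1 (Nat.not_odd_iff_even.1 hi)).symm
  simp only [weight, ceilWeight, size, h, Finset.prod_mul_distrib, Finset.prod_pow_eq_pow_sum,
    mul_assoc]

lemma weight_snoc {n : ℕ} (lam : Fin n → ℕ) (m : ℕ) :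
    weight (Fin.snoc lam m : Fin (n + 1) → ℕ) =
      x ^ m * ceilWeight ⌈(m : ℚ) / ((n : ℚ) + 1)⌉₊ * weight lam := by
  simp [weight_eq_prod, Fin.prod_univ_castSucc, ceilSeq, mul_comm]

/-- The generating function of the lecture hall partitions with `n` parts whose last part is at
most `M`. -/
noncomputable def boundedSeries (n M : ℕ) : Series := ∑ lam ∈ boundedLectureHall n M, weight lam

@[simp]
lemma boundedSeries_zero_left (M : ℕ) : boundedSeries 0 M = 1 := by
  simp [boundedSeries, boundedLectureHall, weight_eq_prod]

lemma boundedSeries_succ_left (n M : ℕ) :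
    boundedSeries (n + 1) M = ∑ m ∈ Finset.range (M + 1),
      x ^ m * ceilWeight ⌈(m : ℚ) / ((n : ℚ) + 1)⌉₊ * boundedSeries n (m * n / (n + 1)) := by
  simp only [boundedSeries, boundedLectureHall, Finset.sum_map, Finset.sum_sigma,
    snocEmbedding_apply, weight_snoc, Finset.mul_sum]

lemma boundedSeries_zero_right (n : ℕ) : boundedSeries n 0 = 1 := by
  induction n with
  | zero => simp
  | succ n ih => simp [boundedSeries_succ_left, ih, ceilWeight]

/-- Splitting off the partitions whose last part attains the bound. -/
lemma boundedSeries_succ_add {n N : ℕ} (t : ℕ) (hN : N ≤ n) :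
    boundedSeries (n + 1) ((n + 1) * t + (N + 1)) =
      boundedSeries (n + 1) ((n + 1) * t + N) +
        x ^ ((n + 1) * t + (N + 1)) * ceilWeight (t + 1) * boundedSeries n (n * t + N) := by
  rw [boundedSeries_succ_left, ← add_assoc, Finset.sum_range_succ, ← boundedSeries_succ_left]
  have hdiv : ((n + 1) * t + N + 1) * n / (n + 1) = n * t + N := by
    rw [Nat.div_eq_iff (by omega)]
    obtain ⟨d, rfl⟩ := Nat.exists_eq_add_of_le hN
    constructor
    · nlinarith
    · have : (N + d + 1) * t + N + 1 = (N + d + 1) * t + N + 1 := rfl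
      zify
      rw [Int.natCast_sub (by omega)]
      push_cast
      nlinarith
  have hceil : ⌈(((n + 1) * t + N + 1 : ℕ) : ℚ) / ((n : ℚ) + 1)⌉₊ = t + 1 := by
    rw [Nat.ceil_eq_iff (by omega), lt_div_iff₀ (by positivity), div_le_iff₀ (by positivity)]
    have : (N : ℚ) ≤ n := by exact_mod_cast hN
    have : (0 : ℚ) ≤ N := by positivity
    push_cast
    constructor
    · nlinarith
    · nlinarith
  rw [hdiv, hceil]

/-- The minimal weight of a block of `m` parts with ceiling `t + 1` on top of `p` smaller parts. -/
noncomputable def blockWeight (t m p : ℕ) : Series :=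
  ∏ j ∈ Finset.range m, (ceilWeight (t + 1) * x ^ (t * (p + 1 + j) + j + 1))

/-- Here `p.1` is the number of parts with ceiling `t + 1`. Splitting off the maximal last part
gives a recurrence in `N` that matches q-Pascal. -/
lemma boundedSeries_mul_add {n N : ℕ} (t : ℕ) (hN : N ≤ n) :
    boundedSeries n (n * t + N) = ∑ p ∈ antidiagonal n,
      gaussBinom x N p.1 * (blockWeight t p.1 p.2 * boundedSeries p.2 (p.2 * t)) := by
  induction N generalizing n with
  | zero =>
    rw [Finset.sum_eq_single (0, n)]
    · simp [blockWeight]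
    · rintro ⟨m, p⟩ hp h0
      rw [gaussBinom_eq_zero_of_lt, zero_mul]
      have : m + p = n := by simpa using hp
      refine Nat.pos_of_ne_zero fun h => h0 ?_
      simp_all
    · simp
  | succ N ih =>
    obtain ⟨n, rfl⟩ : ∃ n', n = n' + 1 := ⟨n - 1, by omega⟩
    rw [boundedSeries_succ_add t (by omega), ih (by omega), ih (by omega),
      sum_antidiagonal_gaussBinom_succ x n N fun m p =>
        blockWeight t m p * boundedSeries p (p * t), Finset.mul_sum]
    congr 1
    refine Finset.sum_congr rfl fun p hp => ?_
    obtain ⟨m, p⟩ := p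
    obtain rfl : m + p = n := by simpa using hp
    -- The exponent `N - m` is truncated, which is harmless as the coefficient vanishes for `N < m`.
    obtain h | h := lt_or_ge N m
    · simp [gaussBinom_eq_zero_of_lt _ h]
    · obtain ⟨d, rfl⟩ := Nat.exists_eq_add_of_le h
      simp only [blockWeight, Finset.prod_range_succ, Nat.add_sub_cancel_left]
      rw [show (m + p + 1) * t + (m + d + 1) = d + (t * (p + 1 + m) + m + 1) by ring, pow_add]
      ring

/-! ### Tails and independence of the threshold -/

/-- The numerator of the generating function of the lecture hall partitions with `k + r` parts,
of which exactly the last `k` have ceiling greater than `t`, relative to the first `r` parts. -/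
noncomputable def tailSeries (t k r : ℕ) : Series :=
  gaussBinom x (k + r) k *
    ((∏ j ∈ Finset.range k, (x ^ (t * (r + 1 + j) + j + 1) *
        (ceilWeight (t + 1) + ceilWeight (t + 2) * x ^ (r + 1 + j)))) *
      ∏ j ∈ Finset.range r, (1 - u ^ 2 * x ^ (k + r + 1 + j)))

lemma x_pow_succ_ne_one (i : ℕ) : x ^ (i + 1) ≠ 1 := by
  intro h
  have := congrArg MvPowerSeries.constantCoeff h
  simp [x] at this

/-- The factor `∏ (X x ^ j + y w)` of the `q`-Chu–Vandermonde identity in reversed order. -/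
lemma prod_range_reverse (q w₁ w₂ z : Series) (r l m : ℕ) :
    ∏ j ∈ Finset.range l, (w₂ * q ^ (r + 1) * q ^ j + z * q ^ (l + m + 2 * r + 1) * w₁) =
      ∏ j ∈ Finset.range l, (q ^ (r + 1 + j) * (w₂ + z * w₁ * q ^ (m + r + 1 + j))) := by
  rw [Finset.prod_mul_distrib,
    ← Finset.prod_range_reflect fun j => w₂ + z * w₁ * q ^ (m + r + 1 + j),
    ← Finset.prod_mul_distrib]
  refine Finset.prod_congr rfl fun j hj => ?_
  obtain ⟨d, rfl⟩ := Nat.exists_eq_add_of_lt (Finset.mem_range.1 hj)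
  rw [show j + d + 1 - 1 - j = d by omega]
  ring

lemma ceilWeight_add_two (c : ℕ) : ceilWeight (c + 2) = u ^ 2 * ceilWeight c := by
  simp [ceilWeight, pow_add]; ring

lemma prod_pow_shift (q : Series) (t r l m : ℕ) :
    (∏ j ∈ Finset.range (l + m), q ^ (t * (r + 1 + j) + j + 1)) *
        ∏ j ∈ Finset.range l, q ^ (r + 1 + j) =
      (∏ j ∈ Finset.range l, q ^ ((t + 1) * (m + r + 1 + j) + j + 1)) *
        ∏ j ∈ Finset.range m, q ^ (t * (r + 1 + j) + j + 1) := by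
  induction l with
  | zero => simp
  | succ l ih =>
    rw [add_right_comm, Finset.prod_range_succ, Finset.prod_range_succ _ l,
      Finset.prod_range_succ _ l, mul_mul_mul_comm, ih]
    ring

/-- Of the `k` tail parts, `p.2` have ceiling exactly `t + 1`, the other `p.1` a larger one. -/
lemma tailSeries_eq_sum (t k r : ℕ) :
    tailSeries t k r = ∑ p ∈ antidiagonal k,
      tailSeries (t + 1) p.1 (p.2 + r) * (gaussBinom x (p.2 + r) p.2 * blockWeight t p.2 r) := by
  rw [tailSeries, Finset.prod_mul_distrib]
  -- This `y` makes the factors `1 - y x^j` continue the product over `range r` to `range (m + r)`,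
  -- as the new tail requires.
  have h := qChuVandermonde x (ceilWeight (t + 2) * x ^ (r + 1)) (u ^ 2 * x ^ (k + 2 * r + 1))
    (ceilWeight (t + 1)) k
  have h' : ∏ j ∈ Finset.range k, (ceilWeight (t + 1) + ceilWeight (t + 2) * x ^ (r + 1 + j)) =
      ∏ j ∈ Finset.range k, (ceilWeight (t + 1) + ceilWeight (t + 2) * x ^ (r + 1) * x ^ j) :=
    Finset.prod_congr rfl fun j _ => by rw [pow_add _ _ j, mul_assoc]
  rw [h', ← h, Finset.mul_sum, Finset.sum_mul, Finset.mul_sum]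
  refine Finset.sum_congr rfl fun p hp => ?_
  obtain ⟨l, m⟩ := p
  obtain rfl : l + m = k := by simpa using hp
  simp only [tailSeries, blockWeight]
  have hg := gaussBinom_mul_gaussBinom x_pow_succ_ne_one l m r
  have hE : ∏ j ∈ Finset.range (m + r), (1 - u ^ 2 * x ^ (l + (m + r) + 1 + j)) =
      (∏ j ∈ Finset.range r, (1 - u ^ 2 * x ^ (l + m + r + 1 + j))) *
        ∏ j ∈ Finset.range m, (1 - u ^ 2 * x ^ (l + m + 2 * r + 1) * x ^ j) := by
    rw [add_comm m r, Finset.prod_range_add]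
    congr 1 <;> refine Finset.prod_congr rfl fun j _ => ?_ <;> ring
  have hs := prod_pow_shift x t r l m
  rw [prod_range_reverse, hE, ← add_assoc l m r, ceilWeight_add_two (t + 1)]
  simp only [Finset.prod_mul_distrib]
  generalize ∏ j ∈ Finset.range m, (1 - u ^ 2 * x ^ (l + m + 2 * r + 1) * x ^ j) = E₁
  generalize ∏ j ∈ Finset.range r, (1 - u ^ 2 * x ^ (l + m + r + 1 + j)) = E₂
  generalize ∏ j ∈ Finset.range l,
    (ceilWeight (t + 2) + u ^ 2 * ceilWeight (t + 1) * x ^ (m + r + 1 + j)) = E₃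
  generalize ∏ j ∈ Finset.range m, ceilWeight (t + 1) = E₄
  generalize ∏ j ∈ Finset.range (l + m), x ^ (t * (r + 1 + j) + j + 1) = c₁ at *
  generalize ∏ j ∈ Finset.range l, x ^ (r + 1 + j) = c₂ at *
  generalize ∏ j ∈ Finset.range l, x ^ ((t + 1) * (m + r + 1 + j) + j + 1) = c₃ at *
  generalize ∏ j ∈ Finset.range m, x ^ (t * (r + 1 + j) + j + 1) = c₄ at *
  linear_combination E₁ * E₂ * E₃ * E₄ *
    (gaussBinom x (l + m + r) (l + m) * gaussBinom x (l + m) l * hs - c₃ * c₄ * hg)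

lemma sum_antidiagonal_assoc {M : Type*} [AddCommMonoid M] (n : ℕ) (f : ℕ → ℕ → ℕ → M) :
    ∑ p ∈ antidiagonal n, ∑ q ∈ antidiagonal p.1, f q.1 q.2 p.2 =
      ∑ p ∈ antidiagonal n, ∑ q ∈ antidiagonal p.2, f p.1 q.1 q.2 := by
  simp only [Finset.sum_sigma']
  refine Finset.sum_nbij' (fun a => ⟨(a.2.1, a.2.2 + a.1.2), (a.2.2, a.1.2)⟩)
    (fun a => ⟨(a.1.1 + a.2.1, a.2.2), (a.1.1, a.2.1)⟩) ?_ ?_ ?_ ?_ ?_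
  all_goals
    rintro ⟨⟨a, b⟩, c, d⟩
    simp only [Finset.mem_sigma, Finset.HasAntidiagonal.mem_antidiagonal]
    rintro ⟨rfl, rfl⟩
    simp [add_assoc]

/-- The sum which splits lecture hall partitions with `n` parts according to the number of parts
with ceiling at most `t` does not depend on `t`. -/
lemma sum_tailSeries_mul_boundedSeries (n t : ℕ) :
    ∑ p ∈ antidiagonal n, tailSeries t p.1 p.2 * boundedSeries p.2 (p.2 * t) =
      ∏ i ∈ Finset.Icc 1 n, (1 + u * v * x ^ i) := by
  induction t with
  | zero =>
    have h := qChuVandermonde x (ceilWeight 1 * x) (u ^ 2 * x ^ (n + 1)) 1 n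
    have hN : ∏ i ∈ Finset.Icc 1 n, (1 + u * v * x ^ i) =
        ∏ j ∈ Finset.range n, (1 + ceilWeight 1 * x * x ^ j) := by
      rw [← Finset.Ico_add_one_right_eq_Icc, Finset.prod_Ico_eq_prod_range]
      refine Finset.prod_congr rfl fun j _ => ?_
      simp [ceilWeight, pow_add]; ring
    rw [hN, ← h]
    refine Finset.sum_congr rfl fun p hp => ?_
    obtain ⟨k, r⟩ := p
    obtain rfl : k + r = n := by simpa using hp
    simp only [tailSeries, mul_zero, boundedSeries_zero_right, mul_one, one_mul, zero_mul, zero_add]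
    have h' := prod_range_reverse x 1 (ceilWeight 1) (u ^ 2) 0 k r
    simp only [zero_add, mul_zero, add_zero, pow_one, mul_one] at h'
    rw [h']
    have h₁ : ∀ j, x ^ (1 + j) * (ceilWeight 1 + u ^ 2 * x ^ (r + 1 + j)) =
        x ^ (j + 1) * (ceilWeight 1 + ceilWeight 2 * x ^ (r + 1 + j)) := fun j => by
      rw [ceilWeight_add_two 0, show ceilWeight 0 = 1 by simp [ceilWeight], add_comm 1 j,
        mul_one]
    have h₂ : ∀ j, (1 - u ^ 2 * x ^ (k + r + 1) * x ^ j) = 1 - u ^ 2 * x ^ (k + r + 1 + j) :=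
      fun j => by rw [mul_assoc, ← pow_add]
    simp only [h₁, h₂]
  | succ t ih =>
    rw [← ih]
    -- The blocks `l, m, r` have ceilings above, equal to and below `t + 1`; the middle one may join
    -- either neighbour.
    have h₁ := sum_antidiagonal_assoc n fun l m r => tailSeries (t + 1) l (m + r) *
      (gaussBinom x (m + r) m * blockWeight t m r) * boundedSeries r (r * t)
    simp only [tailSeries_eq_sum t, Finset.sum_mul]
    rw [h₁]
    refine Finset.sum_congr rfl fun p _ => ?_
    rw [mul_add_one, boundedSeries_mul_add t le_rfl, Finset.mul_sum]
    refine Finset.sum_congr rfl fun q hq => ?_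
    rw [Finset.HasAntidiagonal.mem_antidiagonal.1 hq]
    ring

/-! ### Passage to the limit -/

lemma u_pow_dvd_tailSeries (t k r : ℕ) (hk : k ≠ 0) : u ^ (t + 1) ∣ tailSeries t k r := by
  refine Dvd.dvd.mul_left (Dvd.dvd.mul_right (dvd_trans ?_
    (Finset.dvd_prod_of_mem _ (Finset.mem_range.2 (Nat.pos_of_ne_zero hk)))) _) _
  refine Dvd.dvd.mul_left (dvd_add (Dvd.intro _ rfl) (Dvd.dvd.mul_right ?_ _)) _
  exact (pow_dvd_pow _ (by omega)).trans (Dvd.intro _ rfl)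

lemma u_pow_dvd_boundedSeries_sub (n t : ℕ) :
    u ^ (t + 1) ∣ boundedSeries n (n * t) -
      (∏ i ∈ Finset.Icc 1 n, (1 + u * v * x ^ i)) * MvPowerSeries.invOfUnit
        (∏ i ∈ Finset.Icc (n + 1) (2 * n), (1 - u ^ 2 * x ^ i)) 1 := by
  set Q := ∏ i ∈ Finset.Icc (n + 1) (2 * n), (1 - u ^ 2 * x ^ i) with hQ
  have hinv : Q * MvPowerSeries.invOfUnit Q 1 = 1 :=
    MvPowerSeries.mul_invOfUnit Q 1 (by simp [hQ, u])
  have hQ' : tailSeries t 0 n = Q := by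
    rw [hQ, ← Finset.Ico_add_one_right_eq_Icc, Finset.prod_Ico_eq_prod_range]
    simp [tailSeries, show 2 * n + 1 - (n + 1) = n by omega]
  have hsum := sum_tailSeries_mul_boundedSeries n t
  rw [← Finset.add_sum_erase _ _ (show (0, n) ∈ antidiagonal n by simp)] at hsum
  simp only [hQ'] at hsum
  have hdvd : u ^ (t + 1) ∣ ∑ p ∈ (antidiagonal n).erase (0, n),
      tailSeries t p.1 p.2 * boundedSeries p.2 (p.2 * t) := by
    refine Finset.dvd_sum fun p hp => Dvd.dvd.mul_right (u_pow_dvd_tailSeries t _ _ fun h => ?_) _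
    obtain ⟨k, r⟩ := p
    simp_all
  have : boundedSeries n (n * t) - (∏ i ∈ Finset.Icc 1 n, (1 + u * v * x ^ i)) *
      MvPowerSeries.invOfUnit Q 1 = -MvPowerSeries.invOfUnit Q 1 *
        ∑ p ∈ (antidiagonal n).erase (0, n),
          tailSeries t p.1 p.2 * boundedSeries p.2 (p.2 * t) := by
    linear_combination -boundedSeries n (n * t) * hinv + MvPowerSeries.invOfUnit Q 1 * hsum
  rw [this]
  exact hdvd.mul_left _

lemma coeff_u_pow_mul (b : ℕ) (f : Series) (d : Fin 3 →₀ ℕ) (h : d 1 < b) :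
    MvPowerSeries.coeff d (u ^ b * f) = 0 :=
  MvPowerSeries.X_pow_dvd_iff.1 (Dvd.intro _ rfl) d h

/-- A last part above `n * d 1` has ceiling above `d 1`, so the exponent of `u` is already too
large. -/
lemma coeff_weight_of_notMem {n : ℕ} {d : Fin 3 →₀ ℕ} {lam : Fin n → ℕ} (h : IsLectureHall lam)
    (hlam : lam ∉ boundedLectureHall n (n * d 1)) : MvPowerSeries.coeff d (weight lam) = 0 := by
  rw [mem_boundedLectureHall] at hlam
  push Not at hlam
  obtain ⟨i, hi, hlt⟩ := hlam h
  rw [weight, mul_comm (x ^ _), mul_assoc]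
  refine coeff_u_pow_mul _ _ d (lt_of_lt_of_le ?_
    (Finset.single_le_sum (fun _ _ => Nat.zero_le _) (Finset.mem_univ i)))
  rw [ceilSeq, Nat.lt_ceil, lt_div_iff₀ (by positivity)]
  have h' : (i : ℚ) + 1 = n := by exact_mod_cast hi
  rw [h', mul_comm]
  exact_mod_cast hlt

end LectureHall

/-- The sum converges in `ℤ⟦x, u, v⟧`, unconditionally and coefficientwise, and its value is the
stated quotient. The denominator has constant coefficient `1`, and `invOfUnit _ 1` is its inverse. -/
theorem theoremt (n : ℕ) :
    HasSum
      (fun lam : {lam : Fin n → ℕ // LectureHall.IsLectureHall lam} =>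
        LectureHall.x ^ LectureHall.size lam.1
          * LectureHall.u ^ LectureHall.size (LectureHall.ceilSeq lam.1)
          * LectureHall.v ^ LectureHall.oddCount (LectureHall.ceilSeq lam.1))
      ((∏ i ∈ Finset.Icc 1 n, (1 + LectureHall.u * LectureHall.v * LectureHall.x ^ i))
        * MvPowerSeries.invOfUnit
            (∏ i ∈ Finset.Icc (n + 1) (2 * n), (1 - LectureHall.u ^ 2 * LectureHall.x ^ i)) 1) := by
  classical
  rw [MvPowerSeries.WithPiTopology.hasSum_iff_hasSum_coeff]
  intro d
  -- The threshold `t = d 1` suffices: the error is divisible by `u ^ (d 1 + 1)`.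
  have hcoeff := MvPowerSeries.X_pow_dvd_iff.1 (LectureHall.u_pow_dvd_boundedSeries_sub n (d 1)) d
    (Nat.lt_succ_self _)
  rw [map_sub, sub_eq_zero, LectureHall.boundedSeries, map_sum] at hcoeff
  rw [← hcoeff, ← Finset.sum_subtype_of_mem (p := LectureHall.IsLectureHall) _
    fun lam hlam => ((LectureHall.mem_boundedLectureHall lam).1 hlam).1]
  refine hasSum_sum_of_ne_finset_zero fun lam hlam => ?_
  exact LectureHall.coeff_weight_of_notMem lam.2 fun h => hlam (Finset.mem_subtype.2 h)
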